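/- A lattice path is a sequence of steps $U=(1,1)$ and $D=(1,-1)$ starting at the origin. For integers $a,b\ge0$ let $\mathcal G_{a,b}$ be the set of paths with $a$ steps $U$ and $b$ steps $D$. A valley of a path is a vertex preceded by a $D$ and followed by a $U$, and $\mathrm{maj}(P)$ is the sum of the $x$-coordinates of the valleys of $P$. A crossing of the line $y=\ell$ ($\ell\in\mathbb Z$) is a vertex of the path on this line that is either preceded and followed by a $D$, or preceded and followed by a $U$. For an integer $r\ge0$ let $\mathcal G_{a,b}^{\ge r,\ell}$ be the set of paths in $\mathcal G_{a,b}$ with at least $r$ crossings of the line $y=\ell$, and put $$G_{a,b}^{\ge r,\ell}(q)=\sum_{P\in\mathcal G_{a,b}^{\ge r,\ell}}q^{\mathrm{maj}(P)}.$$ For integers $n\ge0$ and $k$ let $$\binom{n}{k}_q=\frac{(1-q^n)(1-q^{n-1})\cdots(1-q^{n-k+1})}{(1-q^k)(1-q^{k-1})\cdots(1-q)}$$ if $0\le k\le n$, and $\binom{n}{k}_q=0$ otherwise. **Theorem.** Let $a,b,m\ge0$ be integers and let $\ell\in\mathbb Z\setminus\{0\}$. Then the following identities hold (as identities of polynomials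 in $q$). 1. If $0<\ell<a-b$, then $$G_{a,b}^{\ge 2m+1,\ell}(q)=G_{a,b}^{\ge 2m,\ell}(q)=q^{m(2m+1+\ell)}\binom{a+b}{a+2m}_q.$$ 2. If $0>\ell>a-b$, then $$G_{a,b}^{\ge 2m+1,\ell}(q)=G_{a,b}^{\ge 2m,\ell}(q)=q^{m(2m-1-\ell)}\binom{a+b}{a-2m}_q.$$ 3. If $\ell<0$, $\ell<a-b$ and $m\ge1$, then $$G_{a,b}^{\ge 2m,\ell}(q)=G_{a,b}^{\ge 2m-1,\ell}(q)=q^{m(2m-1-\ell)}\binom{a+b}{a+2m-1-\ell}_q.$$ 4. If $\ell>0$, $\ell>a-b$ and $m\ge1$, then $$G_{a,b}^{\ge 2m,\ell}(q)=G_{a,b}^{\ge 2m-1,\ell}(q)=q^{(m-1)(2m-1+\ell)}\binom{a+b}{a-2m+1-\ell}_q.$$ 5. If $0<\ell=a-b$, then $$G_{a,b}^{\ge 2m,\ell}(q)=q^{m(2m+1+\ell)}\binom{a+b}{a+2m}_q,\qquad G_{a,b}^{\ge 2m+1,\ell}(q)=q^{m(2m+1+\ell)}\binom{a+b}{a+2m+1}_q.$$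 6. If $0>\ell=a-b$, then $$G_{a,b}^{\ge 2m,\ell}(q)=q^{m(2m-1-\ell)}\binom{a+b}{a-2m}_q,\qquad G_{a,b}^{\ge 2m+1,\ell}(q)=q^{(m+1)(2m+1-\ell)}\binom{a+b}{a-2m-1}_q.$$ -/

import Mathlib

open Polynomial

namespace LatticePath

/-- The two steps: `U = (1, 1)` (up) and `D = (1, -1)` (down). -/
inductive Step where
  | U : Step
  | D : Step
  deriving DecidableEq

/-- The set `𝒢_{a,b}` of all paths with `a` steps `U` and `b` steps `D` starting at the origin,
a path being given by its sequence of steps (see `mem_paths`). -/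
def paths (a b : ℕ) : Finset (List Step) :=
  (List.replicate a Step.U ++ List.replicate b Step.D).permutations.toFinset

/-- A sequence of steps lies in `paths a b` if and only if it has exactly `a` entries `U` and
`b` entries `D`. -/
theorem mem_paths (a b : ℕ) (P : List Step) :
    P ∈ paths a b ↔ P.count Step.U = a ∧ P.count Step.D = b := by
  simp only [paths, List.mem_toFinset, List.mem_permutations, List.perm_iff_count]
  constructor
  · intro h
    exact ⟨by simpa [List.count_replicate] using h Step.U,
      by simpa [List.count_replicate] using h Step.D⟩
  · rintro ⟨h1, h2⟩ s
    cases s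
    · simp [List.count_replicate, h1]
    · simp [List.count_replicate, h2]

/-- The `y`-coordinate of the vertex of `P` with `x`-coordinate `i`. -/
def height (P : List Step) (i : ℕ) : ℤ :=
  ((P.take i).count Step.U : ℤ) - ((P.take i).count Step.D : ℤ)

/-- The `x`-coordinates of the valleys of `P`: the vertices preceded by a `D` and followed
by a `U`.  (The step before vertex `i` is entry `i - 1` of `P`, the one after it is entry `i`.) -/
def valleys (P : List Step) : Finset ℕ :=
  (Finset.Ioo 0 P.length).filter fun i => P[i - 1]? = some Step.D ∧ P[i]? = some Step.U

/-- The major index: the sum of the `x`-coordinates of the valleys. -/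
def maj (P : List Step) : ℕ := ∑ i ∈ valleys P, i

/-- The `x`-coordinates of the crossings of the line `y = l` by `P`: the vertices on that line
that are preceded and followed by a `D`, or preceded and followed by a `U`. -/
def crossings (l : ℤ) (P : List Step) : Finset ℕ :=
  (Finset.Ioo 0 P.length).filter fun i => height P i = l ∧
    ((P[i - 1]? = some Step.D ∧ P[i]? = some Step.D) ∨
      (P[i - 1]? = some Step.U ∧ P[i]? = some Step.U))

/-- The set `𝒢_{a,b}^{≥ r, l}` of the paths in `𝒢_{a,b}` that cross `y = l` at least `r` times. -/
def pathsCrossing (a b r : ℕ) (l : ℤ) : Finset (List Step) :=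
  (paths a b).filter fun P => r ≤ (crossings l P).card

/-- The polynomial `G_{a,b}^{≥ r, l}(q) = ∑ q ^ maj P`, over the paths `P` in `𝒢_{a,b}` that
cross `y = l` at least `r` times. -/
noncomputable def G (a b r : ℕ) (l : ℤ) : ℤ[X] :=
  ∑ P ∈ pathsCrossing a b r l, X ^ maj P

/-- `G_{a,b}^{≥ r, l}(q)` regarded as a rational function of `q`. -/
noncomputable def GRat (a b r : ℕ) (l : ℤ) : RatFunc ℤ :=
  algebraMap ℤ[X] (RatFunc ℤ) (G a b r l)

/-- The indeterminate `q`, as a rational function. -/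
noncomputable def q : RatFunc ℤ := RatFunc.X

/-- The `q`-binomial coefficient
`((1 - q^n) (1 - q^(n-1)) ⋯ (1 - q^(n-k+1))) / ((1 - q^k) (1 - q^(k-1)) ⋯ (1 - q))`
if `0 ≤ k ≤ n`, and `0` for all other integers `k`. -/
noncomputable def qBinom (n : ℕ) (k : ℤ) : RatFunc ℤ :=
  if 0 ≤ k ∧ k ≤ n then
    (∏ i ∈ Finset.range k.toNat, (1 - q ^ (n - i))) /
      (∏ i ∈ Finset.range k.toNat, (1 - q ^ (i + 1)))
  else 0

end LatticePath

/-!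
The paths are counted by their last step. Appending a step to a nonempty path changes its major
index and its number of crossings in a way that depends only on the last step, the length and the
final height: `DU` creates a valley at the vertex between the two steps, and a repeated step
creates a crossing there if that vertex lies on the line. Hence the generating functions
`lastGF l s r n a` of the paths of length `n + 1` with last step `s`, `a` up steps and at least `r`
crossings satisfy a linear recurrence in `n` (`lastGF_U_succ`, `lastGF_D_succ`), in which `r` drops
by one exactly when a step is repeated on the line.

This recurrence has an explicit solution: in each region (above, on or below the line) and for
each parity of `r`, `lastGF l s r n a` is a power of `q` times a single `q`-binomial coefficient.
The values are listed in `ClosedFormsPos` (line above the origin) and `ClosedFormsNeg` (line below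
the origin), and are verified by induction on `n`. Away from the line each verification is one of
the two `q`-Pascal rules. At the line the height `2 * a - (n + 1)` equals `l`, and there the
reflection `qBinom n k = qBinom n (n - k)` matches the formulas of the two regions.

The generating function of all paths is the sum over the two last steps, which is once more
a `q`-Pascal rule. The index `a` is an arbitrary integer throughout, so that the recurrence needs
no boundary conditions.
-/

namespace LatticePath

/-! ### Gaussian binomial coefficients -/

theorem q_ne_zero : q ≠ 0 := by
  rw [q, ← RatFunc.algebraMap_X, ne_eq, map_eq_zero_iff _ (RatFunc.algebraMap_injective ℤ)]
  exact X_ne_zero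

theorem one_sub_q_pow_ne_zero (i : ℕ) : 1 - q ^ (i + 1) ≠ 0 := by
  have h : (1 - q ^ (i + 1) : RatFunc ℤ) =
      algebraMap ℤ[X] (RatFunc ℤ) (1 - X ^ (i + 1)) := by simp [q]
  rw [h, ne_eq, map_eq_zero_iff _ (RatFunc.algebraMap_injective ℤ)]
  intro h0
  have := congrArg (Polynomial.eval 0) h0
  simp at this

theorem qBinom_of_neg (n : ℕ) {k : ℤ} (hk : k < 0) : qBinom n k = 0 :=
  if_neg fun h => absurd h.1 (not_le.2 hk)

/-- For natural `k` the quotient of products is valid without the bound `k ≤ n`: if `n < k`, the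
numerator has the factor `1 - q ^ 0 = 0`. -/
theorem qBinom_natCast (n k : ℕ) :
    qBinom n k = (∏ i ∈ Finset.range k, (1 - q ^ (n - i))) /
      (∏ i ∈ Finset.range k, (1 - q ^ (i + 1))) := by
  unfold qBinom
  split_ifs with h
  · simp
  · have hk : n < k := by
      by_contra hk
      exact h ⟨by positivity, by exact_mod_cast not_lt.1 hk⟩
    rw [Finset.prod_eq_zero (Finset.mem_range.2 hk) (by simp), zero_div]

theorem qBinom_zero_right (n : ℕ) : qBinom n 0 = 1 := by
  simpa using qBinom_natCast n 0

theorem qBinom_of_lt {n : ℕ} {k : ℤ} (hk : n < k) : qBinom n k = 0 :=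
  if_neg fun h => absurd h.2 (not_le.2 hk)

theorem qBinom_zero_left {k : ℤ} (hk : k ≠ 0) : qBinom 0 k = 0 := by
  rcases lt_or_gt_of_ne hk with h | h
  · exact qBinom_of_neg 0 h
  · exact qBinom_of_lt (by exact_mod_cast h)

theorem qBinom_succ_mul (n k : ℕ) :
    (1 - q ^ (k + 1)) * qBinom n ((k + 1 : ℕ) : ℤ) = (1 - q ^ (n - k)) * qBinom n k := by
  have h := one_sub_q_pow_ne_zero k
  rw [qBinom_natCast, qBinom_natCast, Finset.prod_range_succ, Finset.prod_range_succ]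
  have := Finset.prod_ne_zero_iff.2 fun i (_ : i ∈ Finset.range k) => one_sub_q_pow_ne_zero i
  field_simp

theorem qBinom_succ_succ_mul (n k : ℕ) :
    (1 - q ^ (k + 1)) * qBinom (n + 1) ((k + 1 : ℕ) : ℤ) = (1 - q ^ (n + 1)) * qBinom n k := by
  have h := one_sub_q_pow_ne_zero k
  rw [qBinom_natCast, qBinom_natCast, Finset.prod_range_succ', Finset.prod_range_succ]
  have := Finset.prod_ne_zero_iff.2 fun i (_ : i ∈ Finset.range k) => one_sub_q_pow_ne_zero i
  simp only [Nat.add_sub_add_right, Nat.sub_zero]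
  field_simp

/-- The `q`-Pascal rule with the power of `q` on the term `k - 1`. -/
theorem qBinom_pascal (n : ℕ) (k : ℤ) :
    qBinom (n + 1) k = qBinom n k + q ^ ((n : ℤ) + 1 - k) * qBinom n (k - 1) := by
  rcases lt_trichotomy k 0 with hk | rfl | hk
  · simp [qBinom_of_neg, hk, show k - 1 < 0 by omega]
  · simp [qBinom_zero_right, qBinom_of_neg]
  · obtain ⟨j, rfl⟩ : ∃ j : ℕ, k = ((j + 1 : ℕ) : ℤ) := ⟨(k - 1).toNat, by omega⟩
    rcases le_or_gt j n with hj | hj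
    · apply mul_left_cancel₀ (one_sub_q_pow_ne_zero j)
      rw [mul_add, qBinom_succ_succ_mul, qBinom_succ_mul]
      obtain ⟨c, rfl⟩ := Nat.exists_eq_add_of_le hj
      rw [show (((j + c : ℕ) : ℤ) + 1 - ((j + 1 : ℕ) : ℤ)) = (c : ℕ) by push_cast; ring,
        show (((j + 1 : ℕ) : ℤ) - 1) = (j : ℕ) by push_cast; ring, zpow_natCast,
        Nat.add_sub_cancel_left]
      ring
    · rw [qBinom_of_lt (by push_cast; omega), qBinom_of_lt (by push_cast; omega),
        qBinom_of_lt (by push_cast; omega)]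
      simp

/-- The `q`-Pascal rule with the power of `q` on the term `k`. -/
theorem qBinom_pascal' (n : ℕ) (k : ℤ) :
    qBinom (n + 1) k = qBinom n (k - 1) + q ^ k * qBinom n k := by
  rcases lt_trichotomy k 0 with hk | rfl | hk
  · simp [qBinom_of_neg, hk, show k - 1 < 0 by omega]
  · simp [qBinom_zero_right, qBinom_of_neg]
  · obtain ⟨j, rfl⟩ : ∃ j : ℕ, k = ((j + 1 : ℕ) : ℤ) := ⟨(k - 1).toNat, by omega⟩
    rcases le_or_gt j n with hj | hj
    · apply mul_left_cancel₀ (one_sub_q_pow_ne_zero j)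
      rw [mul_add, mul_left_comm, qBinom_succ_succ_mul, qBinom_succ_mul]
      obtain ⟨c, rfl⟩ := Nat.exists_eq_add_of_le hj
      rw [show (((j + 1 : ℕ) : ℤ) - 1) = (j : ℕ) by push_cast; ring, zpow_natCast,
        Nat.add_sub_cancel_left]
      ring
    · rw [qBinom_of_lt (by push_cast; omega), qBinom_of_lt (by push_cast; omega),
        qBinom_of_lt (by push_cast; omega)]
      simp

theorem qBinom_symm (n : ℕ) (k : ℤ) : qBinom n k = qBinom n (n - k) := by
  induction n generalizing k with
  | zero =>
    rcases eq_or_ne k 0 with rfl | hk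
    · simp
    · rw [qBinom_zero_left hk, qBinom_zero_left (by simpa using hk)]
  | succ n ih =>
    rw [qBinom_pascal, qBinom_pascal', ih k, ih (k - 1)]
    push_cast
    rw [show (n : ℤ) - (k - 1) = n + 1 - k by ring, show (n : ℤ) + 1 - k - 1 = n - k by ring]

theorem qBinom_eq_of_add_eq {n : ℕ} {k k' : ℤ} (h : k + k' = n) : qBinom n k = qBinom n k' := by
  rw [qBinom_symm, ← h, add_sub_cancel_left]

/-! The next four lemmas are the `q`-Pascal rules in the shapes in which they occur when a step
`U` or `D` is appended.  In the primed versions the lower indices on the left are reflected. -/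

theorem qBinom_step_D {n : ℕ} {k k₁ k₂ E E₁ E₂ : ℤ} (hk₁ : k₁ = k - 1) (hk₂ : k₂ = k)
    (hE₁ : E₁ = E + (n + 1 - k)) (hE₂ : E₂ = E) :
    q ^ E₁ * qBinom n k₁ + q ^ E₂ * qBinom n k₂ = q ^ E * qBinom (n + 1) k := by
  rw [hk₁, hk₂, hE₁, hE₂, zpow_add₀ q_ne_zero, qBinom_pascal]
  ring

theorem qBinom_step_D' {n : ℕ} {k k₁ k₂ E E₁ E₂ : ℤ} (hk₁ : k₁ = n + 1 - k) (hk₂ : k₂ = n - k)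
    (hE₁ : E₁ = E + (n + 1 - k)) (hE₂ : E₂ = E) :
    q ^ E₁ * qBinom n k₁ + q ^ E₂ * qBinom n k₂ = q ^ E * qBinom (n + 1) k := by
  rw [qBinom_eq_of_add_eq (k := k₁) (k' := k - 1) (by rw [hk₁]; ring),
    qBinom_eq_of_add_eq (k := k₂) (k' := k) (by rw [hk₂]; ring)]
  exact qBinom_step_D rfl rfl hE₁ hE₂

theorem qBinom_step_U {n : ℕ} {k k₁ k₂ E E₁ E₂ : ℤ} (hk₁ : k₁ = k - 1) (hk₂ : k₂ = k)
    (hE₁ : E₁ = E) (hE₂ : E₂ + (n + 1) = E + k) :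
    q ^ E₁ * qBinom n k₁ + q ^ (n + 1) * (q ^ E₂ * qBinom n k₂) =
      q ^ E * qBinom (n + 1) k := by
  have h : q ^ (n + 1) * q ^ E₂ = q ^ E * q ^ k := by
    rw [← zpow_natCast, ← zpow_add₀ q_ne_zero, ← zpow_add₀ q_ne_zero, ← hE₂]
    congr 1
    push_cast
    ring
  rw [← mul_assoc, h, hk₁, hk₂, hE₁, qBinom_pascal']
  ring

theorem qBinom_step_U' {n : ℕ} {k k₁ k₂ E E₁ E₂ : ℤ} (hk₁ : k₁ = n + 1 - k) (hk₂ : k₂ = n - k)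
    (hE₁ : E₁ = E) (hE₂ : E₂ + (n + 1) = E + k) :
    q ^ E₁ * qBinom n k₁ + q ^ (n + 1) * (q ^ E₂ * qBinom n k₂) =
      q ^ E * qBinom (n + 1) k := by
  rw [qBinom_eq_of_add_eq (k := k₁) (k' := k - 1) (by rw [hk₁]; ring),
    qBinom_eq_of_add_eq (k := k₂) (k' := k) (by rw [hk₂]; ring)]
  exact qBinom_step_U rfl rfl hE₁ hE₂

/-! ### Appending a step to a path -/

theorem getElem?_append_singleton_of_lt {P : List Step} {i : ℕ} (s : Step) (hi : i < P.length) :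
    (P ++ [s])[i]? = P[i]? :=
  List.getElem?_append_left hi

theorem height_append_singleton_of_le {P : List Step} {i : ℕ} (s : Step) (hi : i ≤ P.length) :
    height (P ++ [s]) i = height P i := by
  simp only [height, List.take_append_of_le_length hi]

theorem Ioo_zero_succ {n : ℕ} (hn : 0 < n) :
    Finset.Ioo 0 (n + 1) = insert n (Finset.Ioo 0 n) := by
  ext i
  simp only [Finset.mem_Ioo, Finset.mem_insert]
  omega

theorem count_U_add_count_D (P : List Step) :
    P.count Step.U + P.count Step.D = P.length := by
  induction P with
  | nil => rfl
  | cons s P ih => cases s <;> simp <;> omega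

theorem height_length (P : List Step) :
    height P P.length = 2 * (P.count Step.U : ℤ) - P.length := by
  have := count_U_add_count_D P
  simp only [height, List.take_length]
  omega

/-- The last vertex of a nonempty path becomes a valley when `U` is appended after a `D`. -/
theorem maj_append_singleton (Q : List Step) (t s : Step) :
    maj (Q ++ [t] ++ [s]) =
      maj (Q ++ [t]) + if t = Step.D ∧ s = Step.U then Q.length + 1 else 0 := by
  have hlast : (Q ++ [t] ++ [s])[Q.length + 1]? = some s := by simp
  have hprev : (Q ++ [t] ++ [s])[Q.length]? = some t := by simp
  have hold : (Finset.Ioo 0 (Q.length + 1)).filter (fun i =>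
        (Q ++ [t] ++ [s])[i - 1]? = some Step.D ∧ (Q ++ [t] ++ [s])[i]? = some Step.U) =
      valleys (Q ++ [t]) := by
    unfold valleys
    rw [List.length_append, List.length_singleton]
    refine Finset.filter_congr fun i hi => ?_
    rw [Finset.mem_Ioo] at hi
    rw [getElem?_append_singleton_of_lt s (by simp; omega),
      getElem?_append_singleton_of_lt s (by simp; omega)]
  unfold maj
  conv_lhs => rw [valleys]
  rw [List.length_append, List.length_append, List.length_singleton, List.length_singleton,
    Ioo_zero_succ (by omega), Finset.filter_insert, hold, Nat.add_sub_cancel, hlast, hprev]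
  simp only [Option.some.injEq]
  split_ifs with h
  · rw [Finset.sum_insert (by simp [valleys]), add_comm]
  · simp

/-- The last vertex of a nonempty path becomes a crossing when the last step is repeated there
and the vertex lies on the line. -/
theorem card_crossings_append_singleton (l : ℤ) (Q : List Step) (t s : Step) :
    (crossings l (Q ++ [t] ++ [s])).card =
      (crossings l (Q ++ [t])).card +
        if 2 * ((Q ++ [t]).count Step.U : ℤ) - (Q.length + 1) = l ∧ s = t then 1 else 0 := by
  have hlast : (Q ++ [t] ++ [s])[Q.length + 1]? = some s := by simp
  have hprev : (Q ++ [t] ++ [s])[Q.length]? = some t := by simp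
  have hheight : height (Q ++ [t] ++ [s]) (Q.length + 1) =
      2 * ((Q ++ [t]).count Step.U : ℤ) - (Q.length + 1) := by
    rw [height_append_singleton_of_le s (by simp)]
    simpa using height_length (Q ++ [t])
  have hold : (Finset.Ioo 0 (Q.length + 1)).filter (fun i =>
        height (Q ++ [t] ++ [s]) i = l ∧
          (((Q ++ [t] ++ [s])[i - 1]? = some Step.D ∧ (Q ++ [t] ++ [s])[i]? = some Step.D) ∨
          ((Q ++ [t] ++ [s])[i - 1]? = some Step.U ∧ (Q ++ [t] ++ [s])[i]? = some Step.U))) =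
      crossings l (Q ++ [t]) := by
    unfold crossings
    rw [List.length_append, List.length_singleton]
    refine Finset.filter_congr fun i hi => ?_
    rw [Finset.mem_Ioo] at hi
    rw [getElem?_append_singleton_of_lt s (by simp; omega),
      getElem?_append_singleton_of_lt s (by simp; omega),
      height_append_singleton_of_le s (by simp; omega)]
  have hst : (t = Step.D ∧ s = Step.D ∨ t = Step.U ∧ s = Step.U) ↔ s = t := by
    cases s <;> cases t <;> simp
  conv_lhs => rw [crossings]
  rw [List.length_append, List.length_append, List.length_singleton, List.length_singleton,
    Ioo_zero_succ (by omega), Finset.filter_insert, hold, Nat.add_sub_cancel, hlast, hprev, hheight]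
  simp only [Option.some.injEq, hst]
  split_ifs with h
  · rw [Finset.card_insert_of_notMem (by simp [crossings])]
  · simp

theorem maj_singleton (s : Step) : maj [s] = 0 := by
  simp [maj, valleys, show Finset.Ioo 0 1 = (∅ : Finset ℕ) from rfl]

theorem crossings_singleton (l : ℤ) (s : Step) : crossings l [s] = ∅ := by
  simp [crossings, show Finset.Ioo 0 1 = (∅ : Finset ℕ) from rfl]

/-! ### The generating functions refined by the last step -/

/-- All sequences of `n` steps. -/
def words : ℕ → Finset (List Step)
  | 0 => {[]}
  | n + 1 => (words n).image (· ++ [Step.U]) ∪ (words n).image (· ++ [Step.D])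

theorem mem_words {n : ℕ} {P : List Step} : P ∈ words n ↔ P.length = n := by
  induction n generalizing P with
  | zero => simp [words]
  | succ n ih =>
    simp only [words, Finset.mem_union, Finset.mem_image, ih]
    constructor
    · rintro (⟨Q, rfl, rfl⟩ | ⟨Q, rfl, rfl⟩) <;> simp
    · intro h
      rcases List.eq_nil_or_concat' P with rfl | ⟨Q, s, rfl⟩
      · simp at h
      · have hQ : Q.length = n := by simpa using h
        cases s
        · exact Or.inl ⟨Q, hQ, rfl⟩
        · exact Or.inr ⟨Q, hQ, rfl⟩

theorem sum_words_succ {M : Type*} [AddCommMonoid M] (n : ℕ) (f : List Step → M) :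
    ∑ P ∈ words (n + 1), f P =
      ∑ Q ∈ words n, f (Q ++ [Step.U]) + ∑ Q ∈ words n, f (Q ++ [Step.D]) := by
  rw [words, Finset.sum_union, Finset.sum_image, Finset.sum_image]
  · intro P _ Q _ h
    simpa using h
  · intro P _ Q _ h
    simpa using h
  · rw [Finset.disjoint_left]
    intro P h1 h2
    rw [Finset.mem_image] at h1 h2
    obtain ⟨Q, -, rfl⟩ := h1
    obtain ⟨Q', -, h⟩ := h2
    simpa using (List.append_inj' h rfl).2

/-- The contribution of the path `P` to the generating function of the paths with `a` up steps
and at least `r` crossings of `y = l`. -/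
noncomputable def weight (l : ℤ) (r : ℕ) (a : ℤ) (P : List Step) : RatFunc ℤ :=
  if (P.count Step.U : ℤ) = a ∧ r ≤ (crossings l P).card then q ^ maj P else 0

/-- The generating function by major index of the paths of length `n + 1` with last step `s`,
with `a` up steps and at least `r` crossings of `y = l`.  The integer `a` is unrestricted, and
the length is shifted by one because the empty path has no last step. -/
noncomputable def lastGF (l : ℤ) (s : Step) (r n : ℕ) (a : ℤ) : RatFunc ℤ :=
  ∑ Q ∈ words n, weight l r a (Q ++ [s])

theorem GRat_eq_sum_words (a b r : ℕ) (l : ℤ) :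
    GRat a b r l = ∑ P ∈ words (a + b), weight l r a P := by
  have h : pathsCrossing a b r l = (words (a + b)).filter fun P =>
      (P.count Step.U : ℤ) = a ∧ r ≤ (crossings l P).card := by
    ext P
    have := count_U_add_count_D P
    simp only [pathsCrossing, Finset.mem_filter, mem_paths, mem_words, Nat.cast_inj]
    constructor
    · rintro ⟨⟨h1, h2⟩, h3⟩
      exact ⟨by omega, h1, h3⟩
    · rintro ⟨h1, h2, h3⟩
      exact ⟨⟨h2, by omega⟩, h3⟩
  simp [GRat, G, h, weight, Finset.sum_filter, q, apply_ite]

theorem GRat_eq_lastGF_add {a b n : ℕ} (r : ℕ) (l : ℤ) (h : a + b = n + 1) :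
    GRat a b r l = lastGF l Step.U r n a + lastGF l Step.D r n a := by
  rw [GRat_eq_sum_words, h, sum_words_succ, lastGF, lastGF]

theorem GRat_zero_zero (r : ℕ) (l : ℤ) : GRat 0 0 r l = if r = 0 then 1 else 0 := by
  rw [GRat_eq_sum_words]
  simp [words, weight, crossings, maj, valleys]

theorem lastGF_U_zero (l : ℤ) (r : ℕ) (a : ℤ) :
    lastGF l Step.U r 0 a = if a = 1 ∧ r = 0 then 1 else 0 := by
  simp [lastGF, words, weight, crossings_singleton, maj_singleton, eq_comm]

theorem lastGF_D_zero (l : ℤ) (r : ℕ) (a : ℤ) :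
    lastGF l Step.D r 0 a = if a = 0 ∧ r = 0 then 1 else 0 := by
  simp [lastGF, words, weight, crossings_singleton, maj_singleton, eq_comm]

theorem weight_append_U (l : ℤ) (r : ℕ) (a : ℤ) (Q : List Step) (t : Step) :
    weight l r a (Q ++ [t] ++ [Step.U]) =
      q ^ (if t = Step.D then Q.length + 1 else 0) *
        weight l (r - if 2 * (a - 1) - (Q.length + 1) = l ∧ t = Step.U then 1 else 0) (a - 1)
          (Q ++ [t]) := by
  simp only [weight, maj_append_singleton, card_crossings_append_singleton]
  rw [List.count_append (l₁ := Q ++ [t])]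
  by_cases hc : ((Q ++ [t]).count Step.U : ℤ) = a - 1
  · have hc' : (((Q ++ [t]).count Step.U + [Step.U].count Step.U : ℕ) : ℤ) = a := by
      push_cast; rw [hc]; simp
    simp only [hc, hc', true_and, tsub_le_iff_right, and_true, eq_comm (a := Step.U) (b := t),
      mul_ite, mul_zero, pow_add, mul_comm (q ^ maj _)]
  · have hc' : ¬ (((Q ++ [t]).count Step.U + [Step.U].count Step.U : ℕ) : ℤ) = a := by
      simp only [List.count_singleton_self]
      omega
    simp only [hc, hc', false_and, if_false, mul_zero]

theorem weight_append_D (l : ℤ) (r : ℕ) (a : ℤ) (Q : List Step) (t : Step) :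
    weight l r a (Q ++ [t] ++ [Step.D]) =
      weight l (r - if 2 * a - (Q.length + 1) = l ∧ t = Step.D then 1 else 0) a (Q ++ [t]) := by
  simp only [weight, maj_append_singleton, card_crossings_append_singleton]
  rw [List.count_append (l₁ := Q ++ [t])]
  by_cases hc : ((Q ++ [t]).count Step.U : ℤ) = a
  · have hc' : (((Q ++ [t]).count Step.U + [Step.D].count Step.U : ℕ) : ℤ) = a := by
      simpa using hc
    simp only [hc, hc', true_and, tsub_le_iff_right, eq_comm (a := Step.D) (b := t), reduceCtorEq,
      and_false, if_false, add_zero]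
  · have hc' : ¬ (((Q ++ [t]).count Step.U + [Step.D].count Step.U : ℕ) : ℤ) = a := by
      simpa using hc
    simp only [hc, hc', false_and, if_false]

/-- The recurrence for a last step `U`: repeating `U` on the line creates a crossing, and a `U`
after a `D` turns the vertex with `x`-coordinate `n + 1` into a valley. -/
theorem lastGF_U_succ (l : ℤ) (r n : ℕ) (a : ℤ) :
    lastGF l Step.U r (n + 1) a =
      lastGF l Step.U (r - if 2 * (a - 1) - (n + 1) = l then 1 else 0) n (a - 1) +
        q ^ (n + 1) * lastGF l Step.D r n (a - 1) := by
  rw [lastGF, sum_words_succ, lastGF, lastGF, Finset.mul_sum]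
  congr 1 <;> refine Finset.sum_congr rfl fun Q hQ => ?_ <;> rw [mem_words] at hQ <;>
    rw [weight_append_U, hQ] <;> simp

/-- The recurrence for a last step `D`: repeating `D` on the line creates a crossing. -/
theorem lastGF_D_succ (l : ℤ) (r n : ℕ) (a : ℤ) :
    lastGF l Step.D r (n + 1) a =
      lastGF l Step.U r n a +
        lastGF l Step.D (r - if 2 * a - (n + 1) = l then 1 else 0) n a := by
  rw [lastGF, sum_words_succ, lastGF, lastGF]
  congr 1 <;> refine Finset.sum_congr rfl fun Q hQ => ?_ <;> rw [mem_words] at hQ <;>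
    rw [weight_append_D, hQ] <;> simp

/-! ### Closed forms -/

theorem lastGF_U_succ_of_ne {l : ℤ} {r n : ℕ} {a : ℤ} (h : 2 * (a - 1) - (n + 1) ≠ l) :
    lastGF l Step.U r (n + 1) a =
      lastGF l Step.U r n (a - 1) + q ^ (n + 1) * lastGF l Step.D r n (a - 1) := by
  rw [lastGF_U_succ, if_neg h, Nat.sub_zero]

theorem lastGF_U_succ_of_eq {l : ℤ} {r n : ℕ} {a : ℤ} (h : 2 * (a - 1) - (n + 1) = l) :
    lastGF l Step.U r (n + 1) a =
      lastGF l Step.U (r - 1) n (a - 1) + q ^ (n + 1) * lastGF l Step.D r n (a - 1) := by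
  rw [lastGF_U_succ, if_pos h]

theorem lastGF_D_succ_of_ne {l : ℤ} {r n : ℕ} {a : ℤ} (h : 2 * a - (n + 1) ≠ l) :
    lastGF l Step.D r (n + 1) a = lastGF l Step.U r n a + lastGF l Step.D r n a := by
  rw [lastGF_D_succ, if_neg h, Nat.sub_zero]

theorem lastGF_D_succ_of_eq {l : ℤ} {r n : ℕ} {a : ℤ} (h : 2 * a - (n + 1) = l) :
    lastGF l Step.D r (n + 1) a = lastGF l Step.U r n a + lastGF l Step.D (r - 1) n a := by
  rw [lastGF_D_succ, if_pos h]

/-- Without a condition on crossings: MacMahon's formula, refined by the last step. -/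
theorem lastGF_crossings_zero (l : ℤ) (n : ℕ) (a : ℤ) :
    lastGF l Step.U 0 n a = q ^ ((n : ℤ) + 1 - a) * qBinom n (a - 1) ∧
      lastGF l Step.D 0 n a = q ^ (0 : ℤ) * qBinom n a := by
  induction n generalizing a with
  | zero =>
    rw [lastGF_U_zero, lastGF_D_zero]
    constructor
    · rcases eq_or_ne a 1 with rfl | h
      · simp [qBinom_zero_right]
      · simp [h, qBinom_zero_left (sub_ne_zero.2 h)]
    · rcases eq_or_ne a 0 with rfl | h
      · simp [qBinom_zero_right]
      · simp [h, qBinom_zero_left h]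
  | succ n ih =>
    rw [lastGF_U_succ, lastGF_D_succ, Nat.zero_sub, Nat.zero_sub, (ih _).1, (ih _).2, (ih _).1,
      (ih _).2]
    exact ⟨qBinom_step_U rfl rfl (by push_cast; ring) (by push_cast; ring),
      qBinom_step_D rfl rfl (by ring) rfl⟩

/-- The values of `lastGF` at length `n + 1` for a line above the origin, by the position of the
endpoint, whose height is `2 * a - (n + 1)`. -/
structure ClosedFormsPos (l : ℤ) (n : ℕ) : Prop where
  D_ge : ∀ (a : ℤ) (m r : ℕ), r = 2 * m ∨ r = 2 * m + 1 → l ≤ 2 * a - (n + 1) →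
    lastGF l Step.D r n a = q ^ ((m : ℤ) * (2 * m + 1 + l)) * qBinom n (a + 2 * m)
  U_gt : ∀ (a : ℤ) (m r : ℕ), r = 2 * m ∨ r = 2 * m + 1 → l < 2 * a - (n + 1) →
    lastGF l Step.U r n a =
      q ^ ((m : ℤ) * (2 * m + 1 + l) + (n + 1 - a - 2 * m)) * qBinom n (a + 2 * m - 1)
  U_on_even : ∀ (a : ℤ) (m : ℕ), 2 * a - (n + 1) = l →
    lastGF l Step.U (2 * m) n a =
      q ^ ((m : ℤ) * (2 * m + 1 + l) + (n + 1 - a - 2 * m)) * qBinom n (a + 2 * m - 1)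
  U_on_odd : ∀ (a : ℤ) (m : ℕ), 2 * a - (n + 1) = l →
    lastGF l Step.U (2 * m + 1) n a =
      q ^ ((m : ℤ) * (2 * m + 1 + l) + (a + 2 * m + 1)) * qBinom n (a + 2 * m + 1)
  D_lt : ∀ (a : ℤ) (m r : ℕ), r = 2 * m + 1 ∨ r = 2 * m + 2 → 2 * a - (n + 1) < l →
    lastGF l Step.D r n a = q ^ ((m : ℤ) * (2 * m + 1 + l)) * qBinom n (a - 2 * m - 1 - l)
  U_lt : ∀ (a : ℤ) (m r : ℕ), r = 2 * m + 1 ∨ r = 2 * m + 2 → 2 * a - (n + 1) < l →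
    lastGF l Step.U r n a =
      q ^ ((m : ℤ) * (2 * m + 1 + l) + (n + 1 - (a - 2 * m - 1 - l))) *
        qBinom n (a - 2 * m - 2 - l)

theorem closedFormsPos_zero {l : ℤ} (hl : 0 < l) : ClosedFormsPos l 0 where
  D_ge a m r hr h := by
    rw [lastGF_D_zero, if_neg (by push_cast at h; omega),
      qBinom_zero_left (by push_cast at h; omega), mul_zero]
  U_gt a m r hr h := by
    rw [lastGF_U_zero, if_neg (by push_cast at h; omega),
      qBinom_zero_left (by push_cast at h; omega), mul_zero]
  U_on_even a m h := by
    rw [lastGF_U_zero]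
    push_cast at h
    rcases eq_or_ne (a + 2 * m - 1) 0 with h0 | h0
    · obtain rfl : a = 1 := by omega
      obtain rfl : m = 0 := by omega
      simp [qBinom_zero_right]
    · rw [if_neg (by omega), qBinom_zero_left h0, mul_zero]
  U_on_odd a m h := by
    rw [lastGF_U_zero, if_neg (by omega), qBinom_zero_left (by push_cast at h; omega), mul_zero]
  D_lt a m r hr h := by
    rw [lastGF_D_zero, if_neg (by omega), qBinom_zero_left (by push_cast at h; omega), mul_zero]
  U_lt a m r hr h := by
    rw [lastGF_U_zero, if_neg (by omega), qBinom_zero_left (by push_cast at h; omega), mul_zero]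

theorem ClosedFormsPos.succ {l : ℤ} {n : ℕ} (H : ClosedFormsPos l n) :
    ClosedFormsPos l (n + 1) where
  D_ge a m r hr h := by
    push_cast at h
    rw [lastGF_D_succ_of_ne (by omega), H.U_gt a m r hr (by omega), H.D_ge a m r hr (by omega)]
    exact qBinom_step_D rfl rfl (by ring) rfl
  U_gt a m r hr h := by
    push_cast at h
    rcases eq_or_ne (2 * (a - 1) - ((n : ℤ) + 1)) l with h0 | h0
    -- The last step leaves the line upwards.  After another `U`, one crossing fewer is needed.
    · rw [lastGF_U_succ_of_eq h0, H.D_ge _ m r hr (by omega)]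
      rcases hr with rfl | rfl
      · rcases m with _ | m
        -- For `r = 0` no crossing is required, and `0 - 1 = 0` in `ℕ`.
        · rw [show 2 * 0 - 1 = 2 * 0 from rfl, H.U_on_even _ 0 h0]
          exact qBinom_step_U (by ring) (by ring) (by push_cast; ring) (by push_cast; ring)
        · rw [show 2 * (m + 1) - 1 = 2 * m + 1 by omega, H.U_on_odd _ m h0]
          exact qBinom_step_U (by push_cast; ring) (by ring)
            (by push_cast; linear_combination h0) (by push_cast; ring)
      · rw [Nat.add_sub_cancel, H.U_on_even _ m h0]
        exact qBinom_step_U (by ring) (by ring) (by push_cast; ring) (by push_cast; ring)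
    · rw [lastGF_U_succ_of_ne h0, H.U_gt _ m r hr (by omega), H.D_ge _ m r hr (by omega)]
      exact qBinom_step_U (by ring) (by ring) (by push_cast; ring) (by push_cast; ring)
  U_on_even a m h := by
    -- For `m = 0`, the formulas for endpoints below the line do not cover `r = 0`.
    rcases m with _ | m
    · rw [Nat.mul_zero, (lastGF_crossings_zero l _ a).1]
      simp
    · push_cast at h
      rw [lastGF_U_succ_of_ne (by omega), H.U_lt _ m _ (by omega) (by omega),
        H.D_lt _ m _ (by omega) (by omega),
        qBinom_eq_of_add_eq (n := n + 1) (k' := a - 2 * m - 2 - l)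
          (by push_cast; linear_combination h)]
      exact qBinom_step_U (by ring) (by ring) (by push_cast; ring) (by push_cast; ring)
  U_on_odd a m h := by
    push_cast at h
    rw [lastGF_U_succ_of_ne (by omega), H.U_lt _ m _ (by omega) (by omega),
      H.D_lt _ m _ (by omega) (by omega),
      qBinom_eq_of_add_eq (n := n + 1) (k' := a - 2 * m - 2 - l)
        (by push_cast; linear_combination h)]
    exact qBinom_step_U (by ring) (by ring) (by linear_combination -h) (by linear_combination -h)
  D_lt a m r hr h := by
    push_cast at h
    rcases eq_or_ne (2 * a - ((n : ℤ) + 1)) l with h0 | h0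
    -- The last step leaves the line downwards.  After another `D`, one crossing fewer is needed.
    · rw [lastGF_D_succ_of_eq h0, H.D_ge a m (r - 1) (by omega) (by omega)]
      rcases hr with rfl | rfl
      · rw [H.U_on_odd _ _ h0]
        refine qBinom_step_D' ?_ ?_ ?_ rfl
        · linear_combination h0
        · linear_combination h0
        · linear_combination h0
      · rw [show 2 * m + 2 = 2 * (m + 1) by ring, H.U_on_even _ _ h0]
        refine qBinom_step_D' ?_ ?_ ?_ rfl <;> push_cast
        · linear_combination h0
        · linear_combination h0
        · ring
    · rw [lastGF_D_succ_of_ne h0, H.U_lt a m r hr (by omega), H.D_lt a m r hr (by omega)]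
      exact qBinom_step_D (by ring) rfl (by ring) rfl
  U_lt a m r hr h := by
    push_cast at h
    rw [lastGF_U_succ_of_ne (by omega), H.U_lt _ m r hr (by omega), H.D_lt _ m r hr (by omega)]
    exact qBinom_step_U (by ring) (by ring) (by push_cast; ring) (by push_cast; ring)

theorem closedFormsPos {l : ℤ} (hl : 0 < l) (n : ℕ) : ClosedFormsPos l n := by
  induction n with
  | zero => exact closedFormsPos_zero hl
  | succ n ih => exact ih.succ

/-- The values of `lastGF` at length `n + 1` for a line below the origin, by the position of the
endpoint, whose height is `2 * a - (n + 1)`. -/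
structure ClosedFormsNeg (l : ℤ) (n : ℕ) : Prop where
  U_le : ∀ (a : ℤ) (m r : ℕ), r = 2 * m ∨ r = 2 * m + 1 → 2 * a - (n + 1) ≤ l →
    lastGF l Step.U r n a =
      q ^ ((m : ℤ) * (2 * m - 1 - l) + (n + 1 - (a - 2 * m))) * qBinom n (a - 2 * m - 1)
  D_lt : ∀ (a : ℤ) (m r : ℕ), r = 2 * m ∨ r = 2 * m + 1 → 2 * a - (n + 1) < l →
    lastGF l Step.D r n a = q ^ ((m : ℤ) * (2 * m - 1 - l)) * qBinom n (a - 2 * m)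
  D_on_even : ∀ (a : ℤ) (m : ℕ), 2 * a - (n + 1) = l →
    lastGF l Step.D (2 * m) n a = q ^ ((m : ℤ) * (2 * m - 1 - l)) * qBinom n (a - 2 * m)
  D_on_odd : ∀ (a : ℤ) (m : ℕ), 2 * a - (n + 1) = l →
    lastGF l Step.D (2 * m + 1) n a =
      q ^ (((m : ℤ) + 1) * (2 * m + 1 - l)) * qBinom n (a - 2 * m - 2)
  D_gt : ∀ (a : ℤ) (m r : ℕ), r = 2 * m + 1 ∨ r = 2 * m + 2 → l < 2 * a - (n + 1) →
    lastGF l Step.D r n a =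
      q ^ (((m : ℤ) + 1) * (2 * m + 1 - l)) * qBinom n (a + 2 * m + 1 - l)
  U_gt : ∀ (a : ℤ) (m r : ℕ), r = 2 * m + 1 ∨ r = 2 * m + 2 → l < 2 * a - (n + 1) →
    lastGF l Step.U r n a =
      q ^ (((m : ℤ) + 1) * (2 * m + 1 - l) + (n + 1 - (a + 2 * m + 1 - l))) *
        qBinom n (a + 2 * m - l)

theorem closedFormsNeg_zero {l : ℤ} (hl : l < 0) : ClosedFormsNeg l 0 where
  U_le a m r hr h := by
    rw [lastGF_U_zero, if_neg (by push_cast at h; omega),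
      qBinom_zero_left (by push_cast at h; omega), mul_zero]
  D_lt a m r hr h := by
    rw [lastGF_D_zero, if_neg (by push_cast at h; omega),
      qBinom_zero_left (by push_cast at h; omega), mul_zero]
  D_on_even a m h := by
    rw [lastGF_D_zero]
    push_cast at h
    rcases eq_or_ne (a - 2 * m) 0 with h0 | h0
    · obtain rfl : a = 0 := by omega
      obtain rfl : m = 0 := by omega
      simp [qBinom_zero_right]
    · rw [if_neg (by omega), qBinom_zero_left h0, mul_zero]
  D_on_odd a m h := by
    rw [lastGF_D_zero, if_neg (by omega), qBinom_zero_left (by push_cast at h; omega), mul_zero]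
  D_gt a m r hr h := by
    rw [lastGF_D_zero, if_neg (by omega), qBinom_zero_left (by push_cast at h; omega), mul_zero]
  U_gt a m r hr h := by
    rw [lastGF_U_zero, if_neg (by omega), qBinom_zero_left (by push_cast at h; omega), mul_zero]

theorem ClosedFormsNeg.succ {l : ℤ} {n : ℕ} (H : ClosedFormsNeg l n) :
    ClosedFormsNeg l (n + 1) where
  U_le a m r hr h := by
    push_cast at h
    rw [lastGF_U_succ_of_ne (by omega), H.U_le _ m r hr (by omega), H.D_lt _ m r hr (by omega)]
    exact qBinom_step_U (by ring) (by ring) (by push_cast; ring) (by push_cast; ring)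
  D_lt a m r hr h := by
    push_cast at h
    rcases eq_or_ne (2 * a - ((n : ℤ) + 1)) l with h0 | h0
    -- The last step leaves the line downwards.  After another `D`, one crossing fewer is needed.
    · rw [lastGF_D_succ_of_eq h0, H.U_le a m r hr (by omega)]
      rcases hr with rfl | rfl
      · rcases m with _ | m
        -- For `r = 0` no crossing is required, and `0 - 1 = 0` in `ℕ`.
        · rw [show 2 * 0 - 1 = 2 * 0 from rfl, H.D_on_even _ 0 h0]
          exact qBinom_step_D rfl rfl (by ring) rfl
        · rw [show 2 * (m + 1) - 1 = 2 * m + 1 by omega, H.D_on_odd _ m h0]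
          exact qBinom_step_D rfl (by push_cast; ring) (by ring) (by push_cast; ring)
      · rw [Nat.add_sub_cancel, H.D_on_even _ m h0]
        exact qBinom_step_D rfl rfl (by ring) rfl
    · rw [lastGF_D_succ_of_ne h0, H.U_le _ m r hr (by omega), H.D_lt _ m r hr (by omega)]
      exact qBinom_step_D rfl rfl (by ring) rfl
  D_on_even a m h := by
    -- For `m = 0`, the formulas for endpoints above the line do not cover `r = 0`.
    rcases m with _ | m
    · rw [Nat.mul_zero, (lastGF_crossings_zero l _ a).2]
      simp
    · push_cast at h
      rw [lastGF_D_succ_of_ne (by omega), H.U_gt _ m _ (by omega) (by omega),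
        H.D_gt _ m _ (by omega) (by omega)]
      rw [qBinom_eq_of_add_eq (n := n + 1) (k' := a + 2 * m + 1 - l)
        (by push_cast; linear_combination h)]
      exact qBinom_step_D (by ring) rfl (by push_cast; ring) (by push_cast; ring)
  D_on_odd a m h := by
    push_cast at h
    rw [lastGF_D_succ_of_ne (by omega), H.U_gt _ m _ (by omega) (by omega),
      H.D_gt _ m _ (by omega) (by omega)]
    rw [qBinom_eq_of_add_eq (n := n + 1) (k' := a + 2 * m + 1 - l)
      (by push_cast; linear_combination h)]
    exact qBinom_step_D (by ring) rfl (by ring) rfl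
  D_gt a m r hr h := by
    push_cast at h
    rw [lastGF_D_succ_of_ne (by omega), H.U_gt a m r hr (by omega), H.D_gt a m r hr (by omega)]
    exact qBinom_step_D (by ring) rfl rfl rfl
  U_gt a m r hr h := by
    push_cast at h
    rcases eq_or_ne (2 * (a - 1) - ((n : ℤ) + 1)) l with h0 | h0
    -- The last step leaves the line upwards.  After another `U`, one crossing fewer is needed.
    · rw [lastGF_U_succ_of_eq h0, H.U_le _ m (r - 1) (by omega) (by omega)]
      rcases hr with rfl | rfl
      · rw [H.D_on_odd _ _ h0]
        refine qBinom_step_U' ?_ ?_ ?_ ?_ <;> push_cast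
        · linear_combination h0
        · linear_combination h0
        · ring
        · ring
      · rw [show 2 * m + 2 = 2 * (m + 1) by ring, H.D_on_even _ _ h0]
        refine qBinom_step_U' ?_ ?_ ?_ ?_ <;> push_cast
        · linear_combination h0
        · linear_combination h0
        · ring
        · ring
    · rw [lastGF_U_succ_of_ne h0, H.U_gt _ m r hr (by omega), H.D_gt _ m r hr (by omega)]
      exact qBinom_step_U (by ring) (by ring) (by push_cast; ring) (by push_cast; ring)

theorem closedFormsNeg {l : ℤ} (hl : l < 0) (n : ℕ) : ClosedFormsNeg l n := by
  induction n with
  | zero => exact closedFormsNeg_zero hl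
  | succ n ih => exact ih.succ

/-! ### The generating functions of all paths -/

theorem G_eq_of_GRat_eq {a b r s : ℕ} {l : ℤ} (h : GRat a b r l = GRat a b s l) :
    G a b r l = G a b s l :=
  RatFunc.algebraMap_injective ℤ h

theorem exists_add_eq_succ {a b : ℕ} (h : (a : ℤ) - b ≠ 0) :
    ∃ n : ℕ, a + b = n + 1 ∧ (a : ℤ) + b = n + 1 :=
  ⟨a + b - 1, by omega, by omega⟩

theorem GRat_of_pos_of_lt {a b m r : ℕ} {l : ℤ} (hl : 0 < l) (h : l < (a : ℤ) - b)
    (hr : r = 2 * m ∨ r = 2 * m + 1) :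
    GRat a b r l = q ^ ((m : ℤ) * (2 * m + 1 + l)) * qBinom (a + b) ((a : ℤ) + 2 * m) := by
  obtain ⟨n, hn, hn'⟩ := exists_add_eq_succ (a := a) (b := b) (by omega)
  have H := closedFormsPos hl n
  rw [GRat_eq_lastGF_add r l hn, hn, H.U_gt a m r hr (by omega), H.D_ge a m r hr (by omega)]
  exact qBinom_step_D rfl rfl (by ring) rfl

theorem GRat_of_neg_of_lt {a b m r : ℕ} {l : ℤ} (hl : l < 0) (h : (a : ℤ) - b < l)
    (hr : r = 2 * m ∨ r = 2 * m + 1) :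
    GRat a b r l = q ^ ((m : ℤ) * (2 * m - 1 - l)) * qBinom (a + b) ((a : ℤ) - 2 * m) := by
  obtain ⟨n, hn, hn'⟩ := exists_add_eq_succ (a := a) (b := b) (by omega)
  have H := closedFormsNeg hl n
  rw [GRat_eq_lastGF_add r l hn, hn, H.U_le a m r hr (by omega), H.D_lt a m r hr (by omega)]
  exact qBinom_step_D rfl rfl rfl rfl

theorem GRat_of_neg_of_gt {a b m r : ℕ} {l : ℤ} (hl : l < 0) (h : l < (a : ℤ) - b)
    (hr : r = 2 * m + 1 ∨ r = 2 * m + 2) :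
    GRat a b r l =
      q ^ (((m : ℤ) + 1) * (2 * m + 1 - l)) * qBinom (a + b) ((a : ℤ) + 2 * m + 1 - l) := by
  rcases Nat.eq_zero_or_pos (a + b) with h0 | h0
  · obtain ⟨rfl, rfl⟩ : a = 0 ∧ b = 0 := by omega
    rw [GRat_zero_zero, if_neg (by omega), qBinom_zero_left (by push_cast; omega), mul_zero]
  · obtain ⟨n, hn⟩ := Nat.exists_eq_add_of_le' h0
    have H := closedFormsNeg hl n
    rw [GRat_eq_lastGF_add r l hn, hn, H.U_gt a m r hr (by omega), H.D_gt a m r hr (by omega)]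
    exact qBinom_step_D (by ring) rfl rfl rfl

theorem GRat_of_pos_of_gt {a b m r : ℕ} {l : ℤ} (hl : 0 < l) (h : (a : ℤ) - b < l)
    (hr : r = 2 * m + 1 ∨ r = 2 * m + 2) :
    GRat a b r l =
      q ^ ((m : ℤ) * (2 * m + 1 + l)) * qBinom (a + b) ((a : ℤ) - 2 * m - 1 - l) := by
  rcases Nat.eq_zero_or_pos (a + b) with h0 | h0
  · obtain ⟨rfl, rfl⟩ : a = 0 ∧ b = 0 := by omega
    rw [GRat_zero_zero, if_neg (by omega), qBinom_zero_left (by push_cast; omega), mul_zero]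
  · obtain ⟨n, hn⟩ := Nat.exists_eq_add_of_le' h0
    have H := closedFormsPos hl n
    rw [GRat_eq_lastGF_add r l hn, hn, H.U_lt a m r hr (by omega), H.D_lt a m r hr (by omega)]
    exact qBinom_step_D (by ring) rfl rfl rfl

theorem GRat_even_of_pos_of_eq {a b : ℕ} {l : ℤ} (m : ℕ) (hl : 0 < l) (h : l = (a : ℤ) - b) :
    GRat a b (2 * m) l =
      q ^ ((m : ℤ) * (2 * m + 1 + l)) * qBinom (a + b) ((a : ℤ) + 2 * m) := by
  obtain ⟨n, hn, hn'⟩ := exists_add_eq_succ (a := a) (b := b) (by omega)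
  have H := closedFormsPos hl n
  rw [GRat_eq_lastGF_add _ l hn, hn, H.U_on_even a m (by omega),
    H.D_ge a m _ (by omega) (by omega)]
  exact qBinom_step_D rfl rfl (by ring) rfl

theorem GRat_odd_of_pos_of_eq {a b : ℕ} {l : ℤ} (m : ℕ) (hl : 0 < l) (h : l = (a : ℤ) - b) :
    GRat a b (2 * m + 1) l =
      q ^ ((m : ℤ) * (2 * m + 1 + l)) * qBinom (a + b) ((a : ℤ) + 2 * m + 1) := by
  obtain ⟨n, hn, hn'⟩ := exists_add_eq_succ (a := a) (b := b) (by omega)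
  have H := closedFormsPos hl n
  rw [GRat_eq_lastGF_add _ l hn, hn, H.U_on_odd a m (by omega),
    H.D_ge a m _ (by omega) (by omega),
    qBinom_eq_of_add_eq (n := n + 1) (k' := (n : ℤ) - a - 2 * m) (by push_cast; ring)]
  exact qBinom_step_D' (by ring) (by ring) (by ring) rfl

theorem GRat_even_of_neg_of_eq {a b : ℕ} {l : ℤ} (m : ℕ) (hl : l < 0) (h : l = (a : ℤ) - b) :
    GRat a b (2 * m) l =
      q ^ ((m : ℤ) * (2 * m - 1 - l)) * qBinom (a + b) ((a : ℤ) - 2 * m) := by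
  obtain ⟨n, hn, hn'⟩ := exists_add_eq_succ (a := a) (b := b) (by omega)
  have H := closedFormsNeg hl n
  rw [GRat_eq_lastGF_add _ l hn, hn, H.U_le a m _ (by omega) (by omega),
    H.D_on_even a m (by omega)]
  exact qBinom_step_D rfl rfl rfl rfl

theorem GRat_odd_of_neg_of_eq {a b : ℕ} {l : ℤ} (m : ℕ) (hl : l < 0) (h : l = (a : ℤ) - b) :
    GRat a b (2 * m + 1) l =
      q ^ (((m : ℤ) + 1) * (2 * m + 1 - l)) * qBinom (a + b) ((a : ℤ) - 2 * m - 1) := by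
  obtain ⟨n, hn, hn'⟩ := exists_add_eq_succ (a := a) (b := b) (by omega)
  have H := closedFormsNeg hl n
  rw [GRat_eq_lastGF_add _ l hn, hn, H.U_le a m _ (by omega) (by omega),
    H.D_on_odd a m (by omega),
    qBinom_eq_of_add_eq (n := n + 1) (k' := (n : ℤ) + 2 + 2 * m - a) (by push_cast; ring)]
  exact qBinom_step_D' (by ring) (by ring) (by linear_combination h - hn') rfl

end LatticePath

theorem theorem2 (a b m : ℕ) (l : ℤ) (hl : l ≠ 0) :
    -- start below, end above the line
    (0 < l → l < (a : ℤ) - b →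
      LatticePath.G a b (2 * m + 1) l = LatticePath.G a b (2 * m) l ∧
      LatticePath.GRat a b (2 * m) l =
        LatticePath.q ^ ((m : ℤ) * (2 * m + 1 + l)) *
          LatticePath.qBinom (a + b) ((a : ℤ) + 2 * m)) ∧
    -- start above, end below the line
    (l < 0 → (a : ℤ) - b < l →
      LatticePath.G a b (2 * m + 1) l = LatticePath.G a b (2 * m) l ∧
      LatticePath.GRat a b (2 * m) l =
        LatticePath.q ^ ((m : ℤ) * (2 * m - 1 - l)) *
          LatticePath.qBinom (a + b) ((a : ℤ) - 2 * m)) ∧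
    -- start above, end above the line
    (l < 0 → l < (a : ℤ) - b → 1 ≤ m →
      LatticePath.G a b (2 * m) l = LatticePath.G a b (2 * m - 1) l ∧
      LatticePath.GRat a b (2 * m - 1) l =
        LatticePath.q ^ ((m : ℤ) * (2 * m - 1 - l)) *
          LatticePath.qBinom (a + b) ((a : ℤ) + 2 * m - 1 - l)) ∧
    -- start below, end below the line
    (0 < l → (a : ℤ) - b < l → 1 ≤ m →
      LatticePath.G a b (2 * m) l = LatticePath.G a b (2 * m - 1) l ∧
      LatticePath.GRat a b (2 * m - 1) l =
        LatticePath.q ^ (((m : ℤ) - 1) * (2 * m - 1 + l)) *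
          LatticePath.qBinom (a + b) ((a : ℤ) - 2 * m + 1 - l)) ∧
    -- start below, end on the line
    (0 < l → l = (a : ℤ) - b →
      LatticePath.GRat a b (2 * m) l =
        LatticePath.q ^ ((m : ℤ) * (2 * m + 1 + l)) *
          LatticePath.qBinom (a + b) ((a : ℤ) + 2 * m) ∧
      LatticePath.GRat a b (2 * m + 1) l =
        LatticePath.q ^ ((m : ℤ) * (2 * m + 1 + l)) *
          LatticePath.qBinom (a + b) ((a : ℤ) + 2 * m + 1)) ∧
    -- start above, end on the line
    (l < 0 → l = (a : ℤ) - b →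
      LatticePath.GRat a b (2 * m) l =
        LatticePath.q ^ ((m : ℤ) * (2 * m - 1 - l)) *
          LatticePath.qBinom (a + b) ((a : ℤ) - 2 * m) ∧
      LatticePath.GRat a b (2 * m + 1) l =
        LatticePath.q ^ (((m : ℤ) + 1) * (2 * m + 1 - l)) *
          LatticePath.qBinom (a + b) ((a : ℤ) - 2 * m - 1)) := by
  refine ⟨fun h0 h => ?_, fun h0 h => ?_, fun h0 h hm => ?_, fun h0 h hm => ?_,
    fun h0 h => ⟨LatticePath.GRat_even_of_pos_of_eq m h0 h,
      LatticePath.GRat_odd_of_pos_of_eq m h0 h⟩,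
    fun h0 h => ⟨LatticePath.GRat_even_of_neg_of_eq m h0 h,
      LatticePath.GRat_odd_of_neg_of_eq m h0 h⟩⟩
  · have H := fun r hr => LatticePath.GRat_of_pos_of_lt (m := m) (r := r) h0 h hr
    exact ⟨LatticePath.G_eq_of_GRat_eq ((H _ (Or.inr rfl)).trans (H _ (Or.inl rfl)).symm),
      H _ (Or.inl rfl)⟩
  · have H := fun r hr => LatticePath.GRat_of_neg_of_lt (m := m) (r := r) h0 h hr
    exact ⟨LatticePath.G_eq_of_GRat_eq ((H _ (Or.inr rfl)).trans (H _ (Or.inl rfl)).symm),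
      H _ (Or.inl rfl)⟩
  · obtain ⟨m, rfl⟩ := Nat.exists_eq_add_of_le' hm
    have H := fun r hr => LatticePath.GRat_of_neg_of_gt (m := m) (r := r) h0 h hr
    refine ⟨LatticePath.G_eq_of_GRat_eq ((H _ (Or.inr rfl)).trans (H _ (Or.inl rfl)).symm),
      (H _ (Or.inl rfl)).trans ?_⟩
    congr 2 <;> push_cast <;> ring
  · obtain ⟨m, rfl⟩ := Nat.exists_eq_add_of_le' hm
    have H := fun r hr => LatticePath.GRat_of_pos_of_gt (m := m) (r := r) h0 h hr
    refine ⟨LatticePath.G_eq_of_GRat_eq ((H _ (Or.inr rfl)).trans (H _ (Or.inl rfl)).symm),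
      (H _ (Or.inl rfl)).trans ?_⟩
    congr 2 <;> push_cast <;> ring
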